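/- Let $\mathsf Z$ be a complete separable metric space with its Borel $\sigma$-field, and let $\mathrm Q$ be a Markov kernel on $\mathsf Z$ with a unique invariant probability measure $\pi$. Assume that for some integer $\tau\ge 1$, $$\tfrac12\,\|\mathrm Q^{n}(z,\cdot)-\pi\|_{\mathrm{TV}}\le (1/4)^{\lfloor n/\tau\rfloor}\qquad\text{for all } n\ge 0,\ z\in\mathsf Z,$$ where $\|\cdot\|_{\mathrm{TV}}$ is the total variation norm of signed measures (total mass of the variation). Let $f:\mathsf Z\to\mathbb R$ be measurable with $\sup_z|f(z)|\le 1$, and put $\bar f=f-\pi(f)$. Then the series in $$\sigma_\pi^2(f)=\pi(\bar f^{2})+2\sum_{\ell=1}^{\infty}\pi(\bar f\,\mathrm Q^{\ell}\bar f)$$ converges (absolutely) and $\sigma_\pi^2(f)\ge 0$; let $\sigma_\pi(f)$ be its nonnegative square root. Let $\mathbb P_\pi$ be the law of the Markov chain $(Z_k)_{k\ge 0}$ with kernel $\mathrm Q$ and initial distribution $\pi$, and let $\bar S_n=\sum_{i=0}^{n-1}\{f(Z_i)-\pi(f)\}$. Set $C_{\mathrm{Rm},1}=60\,\mathrm e$,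 $C_{\mathrm{Rm},2}=60$, $D_1=\tfrac{16}{3}\sqrt{19/3}\;C_{\mathrm{Rm},1}$, $D_2=\tfrac{64}{3}\bigl(C_{\mathrm{Rm},2}^{1/2}C_{\mathrm{Rm},1}^{2}+C_{\mathrm{Rm},2}\bigr)$ and $\widetilde{\ln}(s)=\ln(s)\,\log_2(2\ln s)$. Then for every integer $n\ge 0$ and every $\delta\in(0,1/2]$, $$\mathbb P_\pi\Bigl[\,|\bar S_n|\ \ge\ C_{\mathrm{Rm},1}\sqrt2\,\sqrt{n\ln(1/\delta)}\;\sigma_\pi(f)+D_1\,n^{1/4}\tau^{3/4}\,\widetilde{\ln}(1/\delta)+D_2\,\tau\,\widetilde{\ln}(1/\delta)\Bigr]\le\delta .$$ -/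

import Mathlib

open MeasureTheory ProbabilityTheory

noncomputable section

namespace MarkovBernstein

/-- The iterates of a Markov kernel (powers in the monoid of kernels) are Markov kernels. -/
instance isMarkovKernel_pow {Z : Type*} [MeasurableSpace Z] (Q : Kernel Z Z) [IsMarkovKernel Q]
    (n : ℕ) : IsMarkovKernel (Q ^ n) := by
  induction n with
  | zero =>
    rw [pow_zero]
    exact inferInstanceAs (IsMarkovKernel (Kernel.id : Kernel Z Z))
  | succ n ih =>
    rw [pow_succ]
    exact inferInstanceAs (IsMarkovKernel ((Q ^ n) ∘ₖ Q))

/-- The total variation norm `‖μ - ν‖_TV`: the total mass of the total variation measure of the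
signed measure `μ - ν` (so it equals `2` for mutually singular probability measures). -/
def tvNormSub {Z : Type*} [MeasurableSpace Z] (μ ν : Measure Z) [IsFiniteMeasure μ]
    [IsFiniteMeasure ν] : ℝ :=
  (μ.toSignedMeasure - ν.toSignedMeasure).totalVariation.real Set.univ

/-- `π` is the unique invariant probability measure of `Q`, and `Q` is uniformly geometrically
ergodic with mixing time `τ`. -/
structure IsUniformlyErgodic {Z : Type*} [MeasurableSpace Z] (Q : Kernel Z Z) [IsMarkovKernel Q]
    (π : Measure Z) [IsProbabilityMeasure π] (τ : ℕ) : Prop where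
  invariant : Q.Invariant π
  unique : ∀ ν : Measure Z, IsProbabilityMeasure ν → Q.Invariant ν → ν = π
  tau_pos : 0 < τ
  mixing : ∀ (n : ℕ) (z : Z), (1 / 2 : ℝ) * tvNormSub ((Q ^ n) z) π ≤ (1 / 4 : ℝ) ^ (n / τ)

/-- The step kernels of the homogeneous chain: given the past `z₀, …, zₙ`, the next state has law
`Q(zₙ, ·)`. -/
def stepKernel {Z : Type*} [MeasurableSpace Z] (Q : Kernel Z Z) (n : ℕ) :
    Kernel ((i : Finset.Iic n) → (fun _ : ℕ => Z) i) Z :=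
  Q.comap (fun x => x ⟨n, Finset.mem_Iic.2 le_rfl⟩) (measurable_pi_apply _)

instance isMarkovKernel_stepKernel {Z : Type*} [MeasurableSpace Z] (Q : Kernel Z Z)
    [IsMarkovKernel Q] (n : ℕ) : IsMarkovKernel (stepKernel Q n) :=
  inferInstanceAs (IsMarkovKernel (Q.comap _ _))

/-- The law `ℙ_ξ` on `Z^ℕ` of the canonical Markov chain with kernel `Q` and initial
distribution `ξ`. -/
def chainLaw {Z : Type*} [MeasurableSpace Z] (Q : Kernel Z Z) [IsMarkovKernel Q]
    (ξ : Measure Z) : Measure (ℕ → Z) :=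
  Kernel.trajMeasure (X := fun _ => Z) ξ (stepKernel Q)

/-- The centred function `f - π(f)`. -/
def centered {Z : Type*} [MeasurableSpace Z] (π : Measure Z) (f : Z → ℝ) : Z → ℝ :=
  fun z => f z - ∫ y, f y ∂π

/-- The centred additive functional `∑_{i < n} (f(Z_i) - π(f))` of a trajectory. -/
def centeredSum {Z : Type*} [MeasurableSpace Z] (π : Measure Z) (f : Z → ℝ) (n : ℕ)
    (ω : ℕ → Z) : ℝ :=
  ∑ i ∈ Finset.range n, centered π f (ω i)

/-- The stationary autocovariance `π(f̄ · Q^ℓ f̄)` at lag `ℓ`, with `f̄ = f - π(f)`. -/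
def autocov {Z : Type*} [MeasurableSpace Z] (Q : Kernel Z Z) (π : Measure Z) (f : Z → ℝ)
    (l : ℕ) : ℝ :=
  ∫ z, centered π f z * (∫ y, centered π f y ∂((Q ^ l) z)) ∂π

/-- The asymptotic variance `σ²_π(f) = π(f̄²) + 2 ∑_{ℓ ≥ 1} π(f̄ · Q^ℓ f̄)`. -/
def asympVar {Z : Type*} [MeasurableSpace Z] (Q : Kernel Z Z) (π : Measure Z) (f : Z → ℝ) : ℝ :=
  (∫ z, centered π f z ^ 2 ∂π) + 2 * ∑' l : ℕ, autocov Q π f (l + 1)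

/-- The first martingale Rosenthal constant, `60 e`. -/
def CRm1 : ℝ := 60 * Real.exp 1

/-- The second martingale Rosenthal constant, `60`. -/
def CRm2 : ℝ := 60

/-- `D₁ = (16/3) (19/3)^{1/2} C_{Rm,1}`. -/
def D1 : ℝ := 16 / 3 * Real.sqrt (19 / 3) * CRm1

/-- `D₂ = (64/3) (C_{Rm,2}^{1/2} C_{Rm,1}² + C_{Rm,2})`. -/
def D2 : ℝ := 64 / 3 * (Real.sqrt CRm2 * CRm1 ^ 2 + CRm2)

/-- `ln~(s) = ln(s) · log₂(2 ln(s))`. -/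
def lnTilde (s : ℝ) : ℝ := Real.log s * Real.logb 2 (2 * Real.log s)

end MarkovBernstein

end

namespace MarkovBernstein

variable {Z : Type*} [MeasurableSpace Z]

/-! The proof is a Bernstein inequality obtained from two Poisson equations and an exponential
supermartingale. Uniform mixing makes g = ∑ₖ (Qᵏf − π(f)) converge with |g| ≤ (8/3)τ, and g − Qg =
f̄, so the centred sum is, up to a bounded boundary term, a martingale with increments g(Zᵢ₊₁) −
Qg(Zᵢ). The conditional variance h of these increments satisfies π(h) = σ², which gives σ² ≥ 0.
Moreover h − σ² is itself of the form G − QG with |G| ≤ 48τ².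

For |l|τ ≤ 1/1000 the function V = l g + 4l²G − 96l⁴G² satisfies Q e^V ≤ exp(V − l f̄ + 5l²σ²)
(`integral_exp_increment_le`, `lintegral_exp_lyapunov_le`). The term in G trades the fluctuating h
for the constant σ²; the term in G² pays for the second-order cost of having inserted G. Hence each
step costs only l²σ², up to a constant. Iterating along the chain, with |V| ≤ 1/2, bounds the moment
generating function of the sum by exp(1 + 5l²σ²n) (`mgf_centeredSum_le`).

With L = ln(1/δ), Chernoff's bound and a choice of l handle every threshold above 200√(nL)σ + 10⁶τL.
The stated threshold is larger: its first term covers the Gaussian part, its D₂ term covers the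
linear part, and its D₁ term only has to be nonnegative. -/

theorem integrable_of_abs_le {μ : Measure Z} [IsFiniteMeasure μ] {φ : Z → ℝ} (hφ : Measurable φ)
    {C : ℝ} (hC : ∀ z, |φ z| ≤ C) : Integrable φ μ :=
  Integrable.of_bound (f := φ) hφ.aestronglyMeasurable C (ae_of_all _ fun z => hC z)

theorem abs_integral_le_of_abs_le {μ : Measure Z} [IsProbabilityMeasure μ] {φ : Z → ℝ}
    {C : ℝ} (hC : ∀ z, |φ z| ≤ C) : |∫ z, φ z ∂μ| ≤ C := by
  simpa using norm_integral_le_of_norm_le_const (μ := μ) (f := φ) (ae_of_all _ fun z => hC z)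

/-- Integrals of a bounded function against two finite measures differ by at most the bound times
the total variation norm of the difference. -/
theorem abs_integral_sub_integral_le (μ ν : Measure Z) [IsFiniteMeasure μ] [IsFiniteMeasure ν]
    {φ : Z → ℝ} (hφ : Measurable φ) {C : ℝ} (hC : ∀ z, |φ z| ≤ C) :
    |(∫ z, φ z ∂μ) - ∫ z, φ z ∂ν| ≤ C * tvNormSub μ ν := by
  set s := μ.toSignedMeasure - ν.toSignedMeasure with hs
  set j := s.toJordanDecomposition with hj
  have hjs : j.posPart.toSignedMeasure - j.negPart.toSignedMeasure = s :=
    s.toSignedMeasure_toJordanDecomposition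
  -- Moving the negative parts across turns the Jordan decomposition into an equality of positive
  -- measures, against which φ can be integrated.
  have hsum : μ + j.negPart = ν + j.posPart := by
    rw [← Measure.toSignedMeasure_eq_toSignedMeasure_iff, Measure.toSignedMeasure_add,
      Measure.toSignedMeasure_add]
    rw [hs, sub_eq_sub_iff_add_eq_add] at hjs
    rw [add_comm ν.toSignedMeasure, hjs]
  have hi : ∀ (ρ : Measure Z) [IsFiniteMeasure ρ], Integrable φ ρ := fun ρ _ =>
    integrable_of_abs_le hφ hC
  have hint : (∫ z, φ z ∂μ) + ∫ z, φ z ∂j.negPart = (∫ z, φ z ∂ν) + ∫ z, φ z ∂j.posPart := by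
    rw [← integral_add_measure (hi _) (hi _), ← integral_add_measure (hi _) (hi _), hsum]
  have hpos : |∫ z, φ z ∂j.posPart| ≤ C * j.posPart.real Set.univ :=
    norm_integral_le_of_norm_le_const (μ := j.posPart) (f := φ) (ae_of_all _ fun z => hC z)
  have hneg : |∫ z, φ z ∂j.negPart| ≤ C * j.negPart.real Set.univ :=
    norm_integral_le_of_norm_le_const (μ := j.negPart) (f := φ) (ae_of_all _ fun z => hC z)
  have htv : tvNormSub μ ν = j.posPart.real Set.univ + j.negPart.real Set.univ := by
    rw [tvNormSub, SignedMeasure.totalVariation, measureReal_add_apply]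
  rw [htv, abs_le]
  rw [abs_le] at hpos hneg
  constructor <;> linarith [hpos.1, hpos.2, hneg.1, hneg.2]

/-- By Euclidean division by τ, each power of 1/4 is taken by exactly τ indices. -/
theorem hasSum_quarter_pow_div {τ : ℕ} (hτ : 0 < τ) :
    HasSum (fun k : ℕ => (1 / 4 : ℝ) ^ (k / τ)) (4 / 3 * τ) := by
  have : NeZero τ := ⟨hτ.ne'⟩
  have h1 : HasSum (fun k : ℕ => (1 / 4 : ℝ) ^ k) (4 / 3) := by
    have := hasSum_geometric_of_lt_one (r := (1 / 4 : ℝ)) (by norm_num) (by norm_num)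
    norm_num at this ⊢
    exact this
  have h2 : HasSum (fun _ : Fin τ => (1 : ℝ)) τ := by
    simpa using hasSum_fintype (fun _ : Fin τ => (1 : ℝ))
  have h3 := h1.mul h2 (h1.summable.mul_of_nonneg h2.summable (fun _ => by positivity)
    (fun _ => zero_le_one))
  rw [← (Nat.divModEquiv τ).hasSum_iff] at h3
  simpa [Function.comp_def, Nat.divModEquiv] using h3

theorem measurable_integral_kernel (Q : Kernel Z Z) [IsMarkovKernel Q] {φ : Z → ℝ}
    (hφ : Measurable φ) : Measurable fun z => ∫ y, φ y ∂(Q z) :=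
  (hφ.stronglyMeasurable.integral_kernel (κ := Q)).measurable

theorem integral_pow_succ (Q : Kernel Z Z) [IsMarkovKernel Q] {φ : Z → ℝ}
    (hφ : Measurable φ) {C : ℝ} (hC : ∀ z, |φ z| ≤ C) (k : ℕ) (z : Z) :
    ∫ y, φ y ∂((Q ^ (k + 1)) z) = ∫ w, ∫ y, φ y ∂((Q ^ k) w) ∂(Q z) := by
  have h : (Q ^ (k + 1)) = (Q ^ k) ∘ₖ Q := pow_succ Q k
  have h2 : Integrable φ (((Q ^ k) ∘ₖ Q) z) := integrable_of_abs_le hφ hC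
  rw [h, Kernel.integral_comp h2]

theorem integral_integral_of_invariant {Q : Kernel Z Z} [IsMarkovKernel Q] {π : Measure Z}
    [IsProbabilityMeasure π] (hinv : Q.Invariant π) {φ : Z → ℝ}
    (hφ : Measurable φ) {C : ℝ} (hC : ∀ z, |φ z| ≤ C) :
    ∫ z, ∫ y, φ y ∂(Q z) ∂π = ∫ z, φ z ∂π := by
  have h1 : (Q ∘ₖ Kernel.const Unit π) () = π := by
    rw [Kernel.comp_const, Kernel.const_apply, hinv.def]
  have h2 : Integrable φ ((Q ∘ₖ Kernel.const Unit π) ()) := integrable_of_abs_le hφ hC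
  have h3 := Kernel.integral_comp h2
  rw [h1] at h3
  exact h3.symm

/-! ### The Poisson equation -/

/-- The deviation `Q^k φ - π(φ)` of the `k`-th iterate from the stationary mean. -/
noncomputable def deviation (Q : Kernel Z Z) (π : Measure Z) (φ : Z → ℝ) (k : ℕ) (z : Z) : ℝ :=
  (∫ y, φ y ∂((Q ^ k) z)) - ∫ y, φ y ∂π

/-- The solution `∑_k (Q^k φ - π(φ))` of the Poisson equation `u - Q u = φ - π(φ)`. -/
noncomputable def poisson (Q : Kernel Z Z) (π : Measure Z) (φ : Z → ℝ) (z : Z) : ℝ :=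
  ∑' k, deviation Q π φ k z

theorem measurable_deviation (Q : Kernel Z Z) [IsMarkovKernel Q] (π : Measure Z) {φ : Z → ℝ}
    (hφ : Measurable φ) (k : ℕ) : Measurable (deviation Q π φ k) :=
  (measurable_integral_kernel (Q ^ k) hφ).sub_const _

section Poisson

variable {Q : Kernel Z Z} [IsMarkovKernel Q] {π : Measure Z} [IsProbabilityMeasure π] {τ : ℕ}
  {φ : Z → ℝ} {C : ℝ}

theorem abs_deviation_le (hQ : IsUniformlyErgodic Q π τ) (hφ : Measurable φ)
    (hC : ∀ z, |φ z| ≤ C) (k : ℕ) (z : Z) :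
    |deviation Q π φ k z| ≤ 2 * C * (1 / 4 : ℝ) ^ (k / τ) := by
  have h0 : 0 ≤ C := (abs_nonneg _).trans (hC z)
  have h := abs_integral_sub_integral_le ((Q ^ k) z) π hφ hC
  have hm := hQ.mixing k z
  rw [deviation]
  nlinarith

theorem summable_deviation_bound (hQ : IsUniformlyErgodic Q π τ) (C : ℝ) :
    Summable fun k : ℕ => 2 * C * (1 / 4 : ℝ) ^ (k / τ) :=
  (hasSum_quarter_pow_div hQ.tau_pos).summable.mul_left _

theorem summable_deviation (hQ : IsUniformlyErgodic Q π τ) (hφ : Measurable φ)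
    (hC : ∀ z, |φ z| ≤ C) (z : Z) : Summable fun k => deviation Q π φ k z :=
  Summable.of_norm_bounded (summable_deviation_bound hQ C)
    fun k => abs_deviation_le hQ hφ hC k z

theorem abs_poisson_le (hQ : IsUniformlyErgodic Q π τ) (hφ : Measurable φ)
    (hC : ∀ z, |φ z| ≤ C) (z : Z) : |poisson Q π φ z| ≤ 8 / 3 * C * τ := by
  have h := tsum_of_norm_bounded ((hasSum_quarter_pow_div hQ.tau_pos).mul_left (2 * C))
    (f := fun k => deviation Q π φ k z) fun k => abs_deviation_le hQ hφ hC k z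
  rw [Real.norm_eq_abs] at h
  refine h.trans (le_of_eq ?_)
  ring

theorem measurable_poisson (hQ : IsUniformlyErgodic Q π τ) (hφ : Measurable φ)
    (hC : ∀ z, |φ z| ≤ C) : Measurable (poisson Q π φ) := by
  refine measurable_of_tendsto_metrizable
    (f := fun n z => ∑ k ∈ Finset.range n, deviation Q π φ k z) (fun n => ?_) ?_
  · exact Finset.measurable_sum _ fun k _ => measurable_deviation Q π hφ k
  · rw [tendsto_pi_nhds]
    exact fun z => (summable_deviation hQ hφ hC z).hasSum.tendsto_sum_nat

/-- Dominated convergence with the geometric mixing bound. The choice ψ = 1, μ = Q(z,·) yields the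
Poisson equation; ψ = f̄, μ = π yields the autocovariance series. -/
theorem hasSum_integral_mul_deviation (hQ : IsUniformlyErgodic Q π τ) (hφ : Measurable φ)
    (hC : ∀ z, |φ z| ≤ C) (μ : Measure Z) [IsFiniteMeasure μ] {ψ : Z → ℝ}
    (hψ : Measurable ψ) {B : ℝ} (hB : ∀ z, |ψ z| ≤ B) :
    HasSum (fun k => ∫ z, ψ z * deviation Q π φ k z ∂μ) (∫ z, ψ z * poisson Q π φ z ∂μ) := by
  refine hasSum_integral_of_dominated_convergence
    (fun k _ => B * (2 * C * (1 / 4 : ℝ) ^ (k / τ)))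
    (fun k => (hψ.mul (measurable_deviation Q π hφ k)).aestronglyMeasurable)
    (fun k => ae_of_all _ fun z => ?_) (ae_of_all _ fun z => ?_) (integrable_const _)
    (ae_of_all _ fun z => ?_)
  · rw [norm_mul]
    exact mul_le_mul (hB z) (abs_deviation_le hQ hφ hC k z) (norm_nonneg _)
      ((abs_nonneg _).trans (hB z))
  · exact (summable_deviation_bound hQ C).mul_left B
  · exact (summable_deviation hQ hφ hC z).hasSum.mul_left (ψ z)

/-- Integrating against Q(z,·) shifts the series by one index, so only the zeroth term is lost. -/
theorem integral_poisson (hQ : IsUniformlyErgodic Q π τ) (hφ : Measurable φ)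
    (hC : ∀ z, |φ z| ≤ C) (z : Z) :
    ∫ y, poisson Q π φ y ∂(Q z) = poisson Q π φ z - (φ z - ∫ y, φ y ∂π) := by
  have h := hasSum_integral_mul_deviation hQ hφ hC (Q z) (ψ := fun _ => 1) measurable_const
    (B := 1) (by simp)
  simp only [one_mul] at h
  have hstep : ∀ k, ∫ y, deviation Q π φ k y ∂(Q z) = deviation Q π φ (k + 1) z := fun k => by
    simp only [deviation]
    rw [integral_sub _ (integrable_const _), integral_pow_succ Q hφ hC]
    · simp
    · exact integrable_of_abs_le (measurable_integral_kernel (Q ^ k) hφ) fun w =>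
        abs_integral_le_of_abs_le hC
  simp only [hstep] at h
  have h0 : deviation Q π φ 0 z = φ z - ∫ y, φ y ∂π := by
    have : (Q ^ 0) z = Measure.dirac z := by
      rw [pow_zero]; exact Kernel.id_apply z
    rw [deviation, this, integral_dirac' _ _ hφ.stronglyMeasurable]
  rw [← h.tsum_eq, poisson, (summable_deviation hQ hφ hC z).tsum_eq_zero_add, h0]
  ring

end Poisson

/-! ### Asymptotic variance and conditional variance -/

section Variance

variable {Q : Kernel Z Z} [IsMarkovKernel Q] {π : Measure Z} [IsProbabilityMeasure π] {τ : ℕ}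
  {f : Z → ℝ}

theorem abs_centered_le (π : Measure Z) [IsProbabilityMeasure π] (hf1 : ∀ z, |f z| ≤ 1) (z : Z) :
    |centered π f z| ≤ 2 := by
  have h1 := abs_le.1 (hf1 z)
  have h2 := abs_le.1 (abs_integral_le_of_abs_le (μ := π) hf1)
  rw [centered, abs_le]
  constructor <;> linarith [h1.1, h1.2, h2.1, h2.2]

theorem measurable_centered (π : Measure Z) (hf : Measurable f) : Measurable (centered π f) :=
  hf.sub_const _

theorem autocov_eq_integral_mul_deviation (Q : Kernel Z Z) [IsMarkovKernel Q] (π : Measure Z)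
    (hf : Measurable f) (hf1 : ∀ z, |f z| ≤ 1) (l : ℕ) :
    autocov Q π f l = ∫ z, centered π f z * deviation Q π f l z ∂π := by
  rw [autocov]
  congr 1 with z
  rw [deviation]
  congr 1
  simp only [centered]
  rw [integral_sub (integrable_of_abs_le hf hf1) (integrable_const _)]
  simp

theorem hasSum_autocov (hQ : IsUniformlyErgodic Q π τ) (hf : Measurable f)
    (hf1 : ∀ z, |f z| ≤ 1) :
    HasSum (autocov Q π f) (∫ z, centered π f z * poisson Q π f z ∂π) := by
  have h := hasSum_integral_mul_deviation hQ hf hf1 π (measurable_centered π hf)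
    (abs_centered_le π hf1)
  rwa [← funext (autocov_eq_integral_mul_deviation Q π hf hf1)] at h

/-- The function `2 f̄ g - f̄²`, with `g` the Poisson solution of `f`; its stationary mean is the
asymptotic variance of `f`. -/
noncomputable def varDensity (Q : Kernel Z Z) (π : Measure Z) (f : Z → ℝ) (z : Z) : ℝ :=
  2 * (centered π f z * poisson Q π f z) - centered π f z ^ 2

theorem measurable_varDensity (hQ : IsUniformlyErgodic Q π τ) (hf : Measurable f)
    (hf1 : ∀ z, |f z| ≤ 1) : Measurable (varDensity Q π f) :=
  (((measurable_centered π hf).mul (measurable_poisson hQ hf hf1)).const_mul 2).sub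
    ((measurable_centered π hf).pow_const 2)

theorem one_le_tau (hQ : IsUniformlyErgodic Q π τ) : (1 : ℝ) ≤ τ := by
  exact_mod_cast hQ.tau_pos

theorem abs_varDensity_le (hQ : IsUniformlyErgodic Q π τ) (hf : Measurable f)
    (hf1 : ∀ z, |f z| ≤ 1) (z : Z) : |varDensity Q π f z| ≤ 44 / 3 * τ := by
  have h1 := abs_centered_le π hf1 z
  have h2 := abs_poisson_le hQ hf hf1 z
  have h3 : |centered π f z * poisson Q π f z| ≤ 2 * (8 / 3 * 1 * τ) := by
    rw [abs_mul]
    exact mul_le_mul h1 h2 (abs_nonneg _) zero_le_two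
  have h4 : centered π f z ^ 2 ≤ 4 := by
    rw [← sq_abs]; nlinarith [abs_nonneg (centered π f z)]
  have h5 := one_le_tau hQ
  rw [abs_le] at h3
  rw [varDensity, abs_le]
  constructor <;> nlinarith [sq_nonneg (centered π f z)]

/-- The series for π(f̄g) contains lag 0. Doubling it counts that lag twice, where σ² counts it
once, hence the correction −π(f̄²). -/
theorem asympVar_eq_integral_varDensity (hQ : IsUniformlyErgodic Q π τ) (hf : Measurable f)
    (hf1 : ∀ z, |f z| ≤ 1) : asympVar Q π f = ∫ z, varDensity Q π f z ∂π := by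
  have h := hasSum_autocov hQ hf hf1
  have hc := measurable_centered π hf
  have h0 : autocov Q π f 0 = ∫ z, centered π f z ^ 2 ∂π := by
    rw [autocov]
    congr 1 with z
    have : (Q ^ 0) z = Measure.dirac z := by
      rw [pow_zero]; exact Kernel.id_apply z
    rw [this, integral_dirac' _ _ hc.stronglyMeasurable, sq]
  have h1 := h.summable.tsum_eq_zero_add
  rw [h.tsum_eq, h0] at h1
  have i1 : Integrable (fun z => centered π f z * poisson Q π f z) π :=
    integrable_of_abs_le (hc.mul (measurable_poisson hQ hf hf1)) fun z => by
      rw [abs_mul]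
      exact mul_le_mul (abs_centered_le π hf1 z) (abs_poisson_le hQ hf hf1 z) (abs_nonneg _)
        zero_le_two
  have i2 : Integrable (fun z => centered π f z ^ 2) π :=
    integrable_of_abs_le (hc.pow_const 2) (C := 2 ^ 2) fun z => by
      rw [abs_pow]
      exact pow_le_pow_left₀ (abs_nonneg _) (abs_centered_le π hf1 z) 2
  simp only [varDensity]
  rw [asympVar, integral_sub (i1.const_mul 2) i2, integral_const_mul, h1]
  ring

theorem integrable_poisson (hQ : IsUniformlyErgodic Q π τ) (hf : Measurable f)
    (hf1 : ∀ z, |f z| ≤ 1) (μ : Measure Z) [IsFiniteMeasure μ] :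
    Integrable (poisson Q π f) μ :=
  integrable_of_abs_le (measurable_poisson hQ hf hf1) (abs_poisson_le hQ hf hf1)

theorem sq_poisson_le (hQ : IsUniformlyErgodic Q π τ) (hf : Measurable f)
    (hf1 : ∀ z, |f z| ≤ 1) (z : Z) : |poisson Q π f z ^ 2| ≤ (8 / 3 * 1 * τ) ^ 2 := by
  rw [abs_pow]
  exact pow_le_pow_left₀ (abs_nonneg _) (abs_poisson_le hQ hf hf1 z) 2

theorem integrable_sq_poisson (hQ : IsUniformlyErgodic Q π τ) (hf : Measurable f)
    (hf1 : ∀ z, |f z| ≤ 1) (μ : Measure Z) [IsFiniteMeasure μ] :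
    Integrable (fun z => poisson Q π f z ^ 2) μ :=
  integrable_of_abs_le ((measurable_poisson hQ hf hf1).pow_const 2) (sq_poisson_le hQ hf hf1)

/-- The one-step conditional variance of the Poisson solution. -/
noncomputable def condVar (Q : Kernel Z Z) (π : Measure Z) (f : Z → ℝ) (z : Z) : ℝ :=
  ∫ y, (poisson Q π f y - (poisson Q π f z - centered π f z)) ^ 2 ∂(Q z)

theorem condVar_nonneg (Q : Kernel Z Z) (π : Measure Z) (f : Z → ℝ) (z : Z) :
    0 ≤ condVar Q π f z :=
  integral_nonneg fun _ => sq_nonneg _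

/-- This is Qg² − (Qg)² with Qg = g − f̄ expanded. The part Qg² − g² vanishes under π by invariance,
which leaves σ² as the mean. -/
theorem condVar_eq (hQ : IsUniformlyErgodic Q π τ) (hf : Measurable f)
    (hf1 : ∀ z, |f z| ≤ 1) (z : Z) :
    condVar Q π f z = (∫ y, poisson Q π f y ^ 2 ∂(Q z)) - poisson Q π f z ^ 2
      + varDensity Q π f z := by
  set m := poisson Q π f z - centered π f z with hm
  have i1 := integrable_poisson hQ hf hf1 (Q z)
  have i2 := integrable_sq_poisson hQ hf hf1 (Q z)
  have h1 : ∫ y, poisson Q π f y ∂(Q z) = m := integral_poisson hQ hf hf1 z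
  have h2 : ∀ y, (poisson Q π f y - m) ^ 2
      = poisson Q π f y ^ 2 - (2 * m) * poisson Q π f y + m ^ 2 := fun y => by ring
  rw [condVar, ← hm]
  simp only [h2]
  rw [integral_add (f := fun y => poisson Q π f y ^ 2 - (2 * m) * poisson Q π f y)
      (i2.sub (i1.const_mul _)) (integrable_const _),
    integral_sub i2 (i1.const_mul _), integral_const_mul, h1]
  simp only [integral_const, probReal_univ, smul_eq_mul, one_mul, varDensity, hm]
  ring

theorem asympVar_eq_integral_condVar (hQ : IsUniformlyErgodic Q π τ) (hf : Measurable f)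
    (hf1 : ∀ z, |f z| ≤ 1) : asympVar Q π f = ∫ z, condVar Q π f z ∂π := by
  have i2 := integrable_sq_poisson hQ hf hf1 π
  have i3 : Integrable (varDensity Q π f) π :=
    integrable_of_abs_le (measurable_varDensity hQ hf hf1) (abs_varDensity_le hQ hf hf1)
  have i1 : Integrable (fun z => ∫ y, poisson Q π f y ^ 2 ∂(Q z)) π :=
    integrable_of_abs_le (measurable_integral_kernel Q
      ((measurable_poisson hQ hf hf1).pow_const 2)) fun z =>
        abs_integral_le_of_abs_le (sq_poisson_le hQ hf hf1)
  simp only [condVar_eq hQ hf hf1]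
  rw [integral_add (f := fun z => (∫ y, poisson Q π f y ^ 2 ∂(Q z)) - poisson Q π f z ^ 2)
      (i1.sub i2) i3, integral_sub i1 i2,
    integral_integral_of_invariant hQ.invariant ((measurable_poisson hQ hf hf1).pow_const 2)
      (sq_poisson_le hQ hf hf1), sub_self, zero_add, asympVar_eq_integral_varDensity hQ hf hf1]

theorem asympVar_nonneg (hQ : IsUniformlyErgodic Q π τ) (hf : Measurable f)
    (hf1 : ∀ z, |f z| ≤ 1) : 0 ≤ asympVar Q π f := by
  rw [asympVar_eq_integral_condVar hQ hf hf1]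
  exact integral_nonneg (condVar_nonneg Q π f)

/-- A solution `G` of the Poisson equation `G - Q G = h - σ²` for the conditional variance `h`. -/
noncomputable def condVarPoisson (Q : Kernel Z Z) (π : Measure Z) (f : Z → ℝ) (z : Z) : ℝ :=
  poisson Q π (varDensity Q π f) z - poisson Q π f z ^ 2

theorem measurable_condVarPoisson (hQ : IsUniformlyErgodic Q π τ) (hf : Measurable f)
    (hf1 : ∀ z, |f z| ≤ 1) : Measurable (condVarPoisson Q π f) :=
  (measurable_poisson hQ (measurable_varDensity hQ hf hf1) (abs_varDensity_le hQ hf hf1)).sub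
    ((measurable_poisson hQ hf hf1).pow_const 2)

/-- The two pieces contribute (8/3)(44/3) + (8/3)² = 416/9 < 48. -/
theorem abs_condVarPoisson_le (hQ : IsUniformlyErgodic Q π τ) (hf : Measurable f)
    (hf1 : ∀ z, |f z| ≤ 1) (z : Z) : |condVarPoisson Q π f z| ≤ 48 * (τ : ℝ) ^ 2 := by
  have h1 := abs_le.1 (abs_poisson_le hQ (measurable_varDensity hQ hf hf1)
    (abs_varDensity_le hQ hf hf1) z)
  have h2 := abs_le.1 (sq_poisson_le hQ hf hf1 z)
  rw [condVarPoisson, abs_le]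
  constructor <;> nlinarith [h1.1, h1.2, h2.1, h2.2, sq_nonneg (τ : ℝ)]

/-- The Poisson solution of `varDensity` handles that part of `condVar`; the summand −g² produces
the remaining Qg² − g². -/
theorem integral_condVarPoisson (hQ : IsUniformlyErgodic Q π τ) (hf : Measurable f)
    (hf1 : ∀ z, |f z| ≤ 1) (z : Z) :
    ∫ y, condVarPoisson Q π f y ∂(Q z)
      = condVarPoisson Q π f z - (condVar Q π f z - asympVar Q π f) := by
  have hm := measurable_varDensity hQ hf hf1
  have hb := abs_varDensity_le hQ hf hf1
  have i1 : Integrable (poisson Q π (varDensity Q π f)) (Q z) :=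
    integrable_of_abs_le (measurable_poisson hQ hm hb) (abs_poisson_le hQ hm hb)
  simp only [condVarPoisson]
  rw [integral_sub i1 (integrable_sq_poisson hQ hf hf1 _), integral_poisson hQ hm hb,
    condVar_eq hQ hf hf1, asympVar_eq_integral_varDensity hQ hf hf1]
  ring

end Variance

/-! ### One-step exponential estimate -/

/-- The bound is e^X ≤ 1 + X + X² for |X| ≤ 1. The increment of −96l⁴G² supplies −96l⁴D², which
absorbs all squares of D, so D survives only linearly and its conditional variance is never needed.
-/
theorem exp_increment_le {l d D G₀ : ℝ} (hd : |l * d| ≤ 1 / 50) (hD : |l ^ 2 * D| ≤ 1 / 500)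
    (hG : |l ^ 2 * G₀| ≤ 1 / 1000) :
    Real.exp (l * d + 4 * l ^ 2 * D - 96 * l ^ 4 * ((G₀ + D) ^ 2 - G₀ ^ 2))
      ≤ 1 + l * d + (4 * l ^ 2 - 192 * l ^ 4 * G₀) * D + 3 * l ^ 2 * d ^ 2 := by
  set x := l * d with hx
  set e := l ^ 2 * D with he
  set q := l ^ 2 * G₀ with hq
  have h1 : l * d + 4 * l ^ 2 * D - 96 * l ^ 4 * ((G₀ + D) ^ 2 - G₀ ^ 2)
      = x + 4 * e - 96 * (e * (e + 2 * q)) := by rw [hx, he, hq]; ring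
  have h2 : 1 + x + (4 * l ^ 2 - 192 * l ^ 4 * G₀) * D + 3 * l ^ 2 * d ^ 2
      = 1 + x + 4 * e - 192 * (q * e) + 3 * x ^ 2 := by rw [hx, he, hq]; ring
  rw [h1, h2]
  clear_value x e q
  rw [abs_le] at hd hD hG
  have hr : |e + 2 * q| ≤ 1 / 250 := by
    rw [abs_le]; constructor <;> linarith [hD.1, hD.2, hG.1, hG.2]
  have hp : |e * (e + 2 * q)| ≤ 1 / 500 * (1 / 250) := by
    rw [abs_mul]
    exact mul_le_mul (abs_le.2 hD) hr (abs_nonneg _) (by norm_num)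
  have hp' := abs_le.1 hp
  have hX : |x + 4 * e - 96 * (e * (e + 2 * q))| ≤ 1 := by
    rw [abs_le]
    constructor <;> linarith [hd.1, hd.2, hD.1, hD.2, hp'.1, hp'.2]
  have hexp := (abs_le.1 (Real.abs_exp_sub_one_sub_id_le hX)).2
  have hr2 : (e + 2 * q) ^ 2 ≤ (1 / 250) ^ 2 := by
    rw [← sq_abs]; exact pow_le_pow_left₀ (abs_nonneg _) hr 2
  have hw : (e * (e + 2 * q)) ^ 2 ≤ e ^ 2 * (1 / 250) ^ 2 := by
    rw [mul_pow]; exact mul_le_mul_of_nonneg_left hr2 (sq_nonneg e)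
  have hsq : (x + 4 * e - 96 * (e * (e + 2 * q))) ^ 2
      ≤ 3 * (x ^ 2 + (4 * e) ^ 2 + (96 * (e * (e + 2 * q))) ^ 2) := by
    nlinarith [sq_nonneg (x - 4 * e), sq_nonneg (x + 96 * (e * (e + 2 * q))),
      sq_nonneg (4 * e + 96 * (e * (e + 2 * q)))]
  -- X² costs at most 3x² + 48e² + 3(96/250)²e², and the e² terms total less than the available
  -- 96e².
  nlinarith [sq_nonneg e]

/-- After averaging, d has mean 0 and D has mean s − h. The coefficient 4 on D beats the 3 on d², so
h ends up with a nonpositive coefficient: the perturbation 192l²G₀ is below 1 in absolute value. The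
same perturbation raises the coefficient of s from 4 to at most 5. -/
theorem integral_exp_increment_le {ν : Measure Z} [IsProbabilityMeasure ν] {g G : Z → ℝ}
    (hg : Measurable g) (hG : Measurable G) {l a b m h s G₀ : ℝ} (ha : ∀ z, |g z| ≤ a)
    (hb : ∀ z, |G z| ≤ b) (hb₀ : |G₀| ≤ b) (hm : ∫ y, g y ∂ν = m)
    (hh : ∫ y, (g y - m) ^ 2 ∂ν = h) (hs : 0 ≤ s) (hGm : ∫ y, G y ∂ν = G₀ - (h - s))
    (hla : |l| * a ≤ 1 / 100) (hlb : l ^ 2 * b ≤ 1 / 1000) :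
    ∫ y, Real.exp (l * (g y - m) + 4 * l ^ 2 * (G y - G₀) - 96 * l ^ 4 * (G y ^ 2 - G₀ ^ 2)) ∂ν
      ≤ Real.exp (5 * l ^ 2 * s) := by
  have hm' : |m| ≤ a := hm ▸ abs_integral_le_of_abs_le ha
  have hh0 : 0 ≤ h := hh ▸ integral_nonneg fun _ => sq_nonneg _
  have hl2 : (0 : ℝ) ≤ l ^ 2 := sq_nonneg l
  have hdb : ∀ y, |g y - m| ≤ 2 * a := fun y => (abs_sub _ _).trans (by linarith [ha y])
  have hDb : ∀ y, |G y - G₀| ≤ 2 * b := fun y => (abs_sub _ _).trans (by linarith [hb y])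
  have hlg : |l ^ 2 * G₀| ≤ 1 / 1000 := by
    rw [abs_mul, abs_of_nonneg hl2]
    exact (mul_le_mul_of_nonneg_left hb₀ hl2).trans hlb
  have hpt : ∀ y, Real.exp (l * (g y - m) + 4 * l ^ 2 * (G y - G₀)
      - 96 * l ^ 4 * (G y ^ 2 - G₀ ^ 2))
      ≤ 1 + l * (g y - m) + (4 * l ^ 2 - 192 * l ^ 4 * G₀) * (G y - G₀)
        + 3 * l ^ 2 * (g y - m) ^ 2 := fun y => by
    have := exp_increment_le (l := l) (d := g y - m) (D := G y - G₀) (G₀ := G₀) ?_ ?_ hlg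
    · rwa [add_sub_cancel] at this
    · rw [abs_mul]
      nlinarith [mul_le_mul_of_nonneg_left (hdb y) (abs_nonneg l)]
    · rw [abs_mul, abs_of_nonneg hl2]
      nlinarith [mul_le_mul_of_nonneg_left (hDb y) hl2]
  have i1 : Integrable (fun y => g y - m) ν := integrable_of_abs_le (hg.sub_const m) hdb
  have i2 : Integrable (fun y => G y - G₀) ν := integrable_of_abs_le (hG.sub_const G₀) hDb
  have i3 : Integrable (fun y => (g y - m) ^ 2) ν :=
    integrable_of_abs_le ((hg.sub_const m).pow_const 2) (C := (2 * a) ^ 2) fun y => by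
      rw [abs_pow]
      exact pow_le_pow_left₀ (abs_nonneg _) (hdb y) 2
  have e1 : ∫ y, (g y - m) ∂ν = 0 := by
    rw [integral_sub (integrable_of_abs_le hg ha) (integrable_const _), hm]; simp
  have e2 : ∫ y, (G y - G₀) ∂ν = s - h := by
    rw [integral_sub (integrable_of_abs_le hG hb) (integrable_const _), hGm]; simp
  have j1 := (integrable_const (μ := ν) (1 : ℝ)).add (i1.const_mul l)
  have j2 := j1.add (i2.const_mul (4 * l ^ 2 - 192 * l ^ 4 * G₀))
  have j3 := i3.const_mul (3 * l ^ 2)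
  have hint := integral_mono_of_nonneg (μ := ν) (ae_of_all _ fun y => (Real.exp_pos _).le)
    (j2.add j3) (ae_of_all _ hpt)
  have hval : ∫ y, (1 + l * (g y - m) + (4 * l ^ 2 - 192 * l ^ 4 * G₀) * (G y - G₀)
        + 3 * l ^ 2 * (g y - m) ^ 2) ∂ν
      = 1 + (4 * l ^ 2 - 192 * l ^ 4 * G₀) * (s - h) + 3 * l ^ 2 * h := by
    rw [integral_add (f := fun y => 1 + l * (g y - m)
        + (4 * l ^ 2 - 192 * l ^ 4 * G₀) * (G y - G₀)) j2 j3,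
      integral_add (f := fun y => 1 + l * (g y - m)) j1 (i2.const_mul _),
      integral_add (integrable_const _) (i1.const_mul _), integral_const_mul, integral_const_mul,
      integral_const_mul, e1, e2, hh]
    simp
  refine hint.trans (le_trans (le_of_eq hval) ?_)
  have hq := abs_le.1 hlg
  have hfin : (4 * l ^ 2 - 192 * l ^ 4 * G₀) * (s - h) + 3 * l ^ 2 * h ≤ 5 * l ^ 2 * s := by
    have e : 5 * l ^ 2 * s - ((4 * l ^ 2 - 192 * l ^ 4 * G₀) * (s - h) + 3 * l ^ 2 * h)
        = l ^ 2 * (s * (1 + 192 * (l ^ 2 * G₀)) + h * (1 - 192 * (l ^ 2 * G₀))) := by ring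
    have : 0 ≤ l ^ 2 * (s * (1 + 192 * (l ^ 2 * G₀)) + h * (1 - 192 * (l ^ 2 * G₀))) :=
      mul_nonneg hl2 (add_nonneg (mul_nonneg hs (by linarith [hq.1]))
        (mul_nonneg hh0 (by linarith [hq.2])))
    linarith
  linarith [Real.add_one_le_exp (5 * l ^ 2 * s)]

/-! ### Markov property and iteration along the chain -/

instance isProbabilityMeasure_chainLaw (Q : Kernel Z Z) [IsMarkovKernel Q] (ξ : Measure Z)
    [IsProbabilityMeasure ξ] : IsProbabilityMeasure (chainLaw Q ξ) :=
  inferInstanceAs (IsProbabilityMeasure (Kernel.trajMeasure (X := fun _ => Z) ξ (stepKernel Q)))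

/-- The Markov property: given the trajectory up to time `n`, the next state has law
`Q(ω n, ·)`. -/
theorem lintegral_chainLaw_succ (Q : Kernel Z Z) [IsMarkovKernel Q] (ξ : Measure Z)
    [IsProbabilityMeasure ξ] (n : ℕ) {A : (Finset.Iic n → Z) → ENNReal} (hA : Measurable A)
    {u : Z → ENNReal} (hu : Measurable u) :
    ∫⁻ ω, A (Preorder.frestrictLe n ω) * u (ω (n + 1)) ∂(chainLaw Q ξ)
      = ∫⁻ ω, A (Preorder.frestrictLe n ω) * ∫⁻ y, u y ∂(Q (ω n)) ∂(chainLaw Q ξ) := by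
  have hF : Measurable fun p : (Finset.Iic n → Z) × Z => A p.1 * u p.2 :=
    (hA.comp measurable_fst).mul (hu.comp measurable_snd)
  have hr : Measurable (Preorder.frestrictLe (π := fun _ : ℕ => Z) n) :=
    Preorder.measurable_frestrictLe n
  have hmap := Kernel.map_frestrictLe_trajMeasure_compProd_eq_map_trajMeasure
    (X := fun _ => Z) (μ₀ := ξ) (κ := stepKernel Q) (a := n)
  have h1 := lintegral_map (μ := chainLaw Q ξ) hF
    (hr.prodMk (measurable_pi_apply (n + 1)))
  refine h1.symm.trans ?_
  rw [chainLaw, ← hmap, Measure.lintegral_compProd hF,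
    lintegral_map hF.lintegral_kernel_prod_right' hr]
  refine lintegral_congr fun ω => ?_
  exact lintegral_const_mul (μ := Q (ω n)) (A (Preorder.frestrictLe n ω)) hu

theorem measurable_centeredSum {π : Measure Z} {f : Z → ℝ} (hf : Measurable f) (n : ℕ) :
    Measurable (centeredSum π f n) :=
  Finset.measurable_sum _ fun i _ => (measurable_centered π hf).comp (measurable_pi_apply i)

/-- Iterating a one-step multiplicative drift condition along the chain. -/
theorem lintegral_exp_centeredSum_le (Q : Kernel Z Z) [IsMarkovKernel Q] (ξ π : Measure Z)
    [IsProbabilityMeasure ξ] {f V : Z → ℝ} (hf : Measurable f) (hV : Measurable V) {l c b : ℝ}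
    (hb : ∀ z, V z ≤ b)
    (hstep : ∀ z, ∫⁻ y, ENNReal.ofReal (Real.exp (V y)) ∂(Q z)
      ≤ ENNReal.ofReal (Real.exp (V z - l * centered π f z + c))) (n : ℕ) :
    ∫⁻ ω, ENNReal.ofReal (Real.exp (l * centeredSum π f n ω + V (ω n))) ∂(chainLaw Q ξ)
      ≤ ENNReal.ofReal (Real.exp (b + c * n)) := by
  induction n with
  | zero =>
    refine (lintegral_mono (g := fun _ => ENNReal.ofReal (Real.exp b)) fun ω => ?_).trans ?_
    · exact ENNReal.ofReal_le_ofReal (Real.exp_le_exp.2 (by simpa [centeredSum] using hb (ω 0)))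
    · simp
  | succ n ih =>
    -- The sum of n + 1 terms involves only Z₀, …, Zₙ, so it belongs to the past when Zₙ₊₁ is
    -- averaged out.
    set A : (Finset.Iic n → Z) → ENNReal := fun x =>
      ENNReal.ofReal (Real.exp (l * ∑ i, centered π f (x i))) with hAdef
    have hA : Measurable A := by
      refine ENNReal.measurable_ofReal.comp (Real.measurable_exp.comp (Measurable.const_mul ?_ l))
      exact Finset.measurable_sum _ fun i _ =>
        (measurable_centered π hf).comp (measurable_pi_apply i)
    have hAeq : ∀ ω : ℕ → Z, A (Preorder.frestrictLe n ω)
        = ENNReal.ofReal (Real.exp (l * centeredSum π f (n + 1) ω)) := fun ω => by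
      rw [hAdef, centeredSum, Nat.range_succ_eq_Iic,
        ← Finset.sum_coe_sort (Finset.Iic n) fun i => centered π f (ω i)]
      rfl
    have hu : Measurable fun y => ENNReal.ofReal (Real.exp (V y)) :=
      ENNReal.measurable_ofReal.comp (Real.measurable_exp.comp hV)
    calc ∫⁻ ω, ENNReal.ofReal (Real.exp (l * centeredSum π f (n + 1) ω + V (ω (n + 1))))
          ∂(chainLaw Q ξ)
        = ∫⁻ ω, A (Preorder.frestrictLe n ω) * ENNReal.ofReal (Real.exp (V (ω (n + 1))))
          ∂(chainLaw Q ξ) := by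
          refine lintegral_congr fun ω => ?_
          rw [hAeq, Real.exp_add, ENNReal.ofReal_mul (Real.exp_pos _).le]
      _ = ∫⁻ ω, A (Preorder.frestrictLe n ω) * ∫⁻ y, ENNReal.ofReal (Real.exp (V y)) ∂(Q (ω n))
          ∂(chainLaw Q ξ) := lintegral_chainLaw_succ Q ξ n hA hu
      _ ≤ ∫⁻ ω, ENNReal.ofReal (Real.exp (l * centeredSum π f n ω + V (ω n)))
          * ENNReal.ofReal (Real.exp c) ∂(chainLaw Q ξ) := by
          refine lintegral_mono fun ω => ?_
          refine (mul_le_mul_right (hstep (ω n)) _).trans (le_of_eq ?_)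
          rw [hAeq, ← ENNReal.ofReal_mul (Real.exp_pos _).le, ← Real.exp_add,
            ← ENNReal.ofReal_mul (Real.exp_pos _).le, ← Real.exp_add, centeredSum,
            Finset.sum_range_succ, ← centeredSum]
          congr 2
          ring
      _ ≤ ENNReal.ofReal (Real.exp (b + c * n)) * ENNReal.ofReal (Real.exp c) := by
          rw [lintegral_mul_const' _ _ ENNReal.ofReal_ne_top]
          exact mul_le_mul_left ih _
      _ = ENNReal.ofReal (Real.exp (b + c * (n + 1 : ℕ))) := by
          rw [← ENNReal.ofReal_mul (Real.exp_pos _).le, ← Real.exp_add]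
          congr 2
          push_cast
          ring

/-! ### Moment generating function and Chernoff bound -/

section Tail

variable {Q : Kernel Z Z} [IsMarkovKernel Q] {π : Measure Z} [IsProbabilityMeasure π] {τ : ℕ}
  {f : Z → ℝ}

/-- The exponential Lyapunov function `l g + 4 l² G - 96 l⁴ G²`. -/
noncomputable def lyapunov (Q : Kernel Z Z) (π : Measure Z) (f : Z → ℝ) (l : ℝ) (z : Z) : ℝ :=
  l * poisson Q π f z + 4 * l ^ 2 * condVarPoisson Q π f z
    - 96 * l ^ 4 * condVarPoisson Q π f z ^ 2

theorem measurable_lyapunov (hQ : IsUniformlyErgodic Q π τ) (hf : Measurable f)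
    (hf1 : ∀ z, |f z| ≤ 1) (l : ℝ) : Measurable (lyapunov Q π f l) :=
  (((measurable_poisson hQ hf hf1).const_mul l).add
    ((measurable_condVarPoisson hQ hf hf1).const_mul _)).sub
      (((measurable_condVarPoisson hQ hf hf1).pow_const 2).const_mul _)

theorem abs_lyapunov_le (hQ : IsUniformlyErgodic Q π τ) (hf : Measurable f)
    (hf1 : ∀ z, |f z| ≤ 1) {l : ℝ} (hl : |l| * τ ≤ 1 / 1000) (z : Z) :
    |lyapunov Q π f l z| ≤ 1 / 2 := by
  have h1 : |l * poisson Q π f z| ≤ 1 / 100 := by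
    rw [abs_mul]
    nlinarith [mul_le_mul_of_nonneg_left (abs_poisson_le hQ hf hf1 z) (abs_nonneg l)]
  have h2 : |l ^ 2 * condVarPoisson Q π f z| ≤ 1 / 1000 := by
    rw [abs_mul, abs_pow]
    have := mul_le_mul_of_nonneg_left (abs_condVarPoisson_le hQ hf hf1 z) (sq_nonneg |l|)
    have h3 : 0 ≤ |l| * τ := by positivity
    nlinarith
  have e : lyapunov Q π f l z = l * poisson Q π f z + 4 * (l ^ 2 * condVarPoisson Q π f z)
      - 96 * (l ^ 2 * condVarPoisson Q π f z) ^ 2 := by rw [lyapunov]; ring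
  rw [e]
  rw [abs_le] at h1 h2
  rw [abs_le]
  constructor <;> nlinarith [h1.1, h1.2, h2.1, h2.2]

theorem lintegral_exp_lyapunov_le (hQ : IsUniformlyErgodic Q π τ) (hf : Measurable f)
    (hf1 : ∀ z, |f z| ≤ 1) {l : ℝ} (hl : |l| * τ ≤ 1 / 1000) (z : Z) :
    ∫⁻ y, ENNReal.ofReal (Real.exp (lyapunov Q π f l y)) ∂(Q z)
      ≤ ENNReal.ofReal (Real.exp (lyapunov Q π f l z - l * centered π f z
        + 5 * l ^ 2 * asympVar Q π f)) := by
  have hlb : l ^ 2 * (48 * (τ : ℝ) ^ 2) ≤ 1 / 1000 := by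
    have h3 : 0 ≤ |l| * τ := by positivity
    rw [← sq_abs]
    nlinarith
  have key := integral_exp_increment_le (ν := Q z) (measurable_poisson hQ hf hf1)
    (measurable_condVarPoisson hQ hf hf1) (l := l) (abs_poisson_le hQ hf hf1)
    (abs_condVarPoisson_le hQ hf hf1) (abs_condVarPoisson_le hQ hf hf1 z)
    (integral_poisson hQ hf hf1 z) (h := condVar Q π f z) rfl (asympVar_nonneg hQ hf hf1)
    (integral_condVarPoisson hQ hf hf1 z) (by linarith) hlb
  have hi : Integrable (fun y => Real.exp (lyapunov Q π f l y)) (Q z) :=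
    integrable_of_abs_le (Real.measurable_exp.comp (measurable_lyapunov hQ hf hf1 l))
      (C := Real.exp (1 / 2)) fun y => by
        rw [abs_of_pos (Real.exp_pos _)]
        exact Real.exp_le_exp.2 (abs_le.1 (abs_lyapunov_le hQ hf hf1 hl y)).2
  rw [← ofReal_integral_eq_lintegral_ofReal hi (ae_of_all _ fun y => (Real.exp_pos _).le)]
  refine ENNReal.ofReal_le_ofReal ?_
  rw [Real.exp_add]
  refine le_trans (le_of_eq ?_) (mul_le_mul_of_nonneg_left key (Real.exp_pos _).le)
  rw [← integral_const_mul]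
  congr 1 with y
  rw [← Real.exp_add]
  congr 1
  simp only [lyapunov, centered]
  ring

theorem abs_centeredSum_le (π : Measure Z) [IsProbabilityMeasure π] (hf1 : ∀ z, |f z| ≤ 1)
    (n : ℕ) (ω : ℕ → Z) : |centeredSum π f n ω| ≤ n * 2 := by
  refine (Finset.abs_sum_le_sum_abs _ _).trans ?_
  refine (Finset.sum_le_sum fun i _ => abs_centered_le π hf1 (ω i)).trans ?_
  simp

theorem integrable_exp_centeredSum (π : Measure Z) [IsProbabilityMeasure π] (hf : Measurable f)
    (hf1 : ∀ z, |f z| ≤ 1) (P : Measure (ℕ → Z)) [IsFiniteMeasure P] (n : ℕ) (l : ℝ) :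
    Integrable (fun ω => Real.exp (l * centeredSum π f n ω)) P :=
  integrable_of_abs_le (Real.measurable_exp.comp ((measurable_centeredSum hf n).const_mul l))
    (C := Real.exp (|l| * (n * 2))) fun ω => by
      rw [abs_of_pos (Real.exp_pos _)]
      refine Real.exp_le_exp.2 ((le_abs_self _).trans ?_)
      rw [abs_mul]
      exact mul_le_mul_of_nonneg_left (abs_centeredSum_le π hf1 n ω) (abs_nonneg l)

/-- Sub-gamma bound on the moment generating function of the additive functional. -/
theorem mgf_centeredSum_le (hQ : IsUniformlyErgodic Q π τ) (hf : Measurable f)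
    (hf1 : ∀ z, |f z| ≤ 1) (ξ : Measure Z) [IsProbabilityMeasure ξ] {l : ℝ}
    (hl : |l| * τ ≤ 1 / 1000) (n : ℕ) :
    mgf (centeredSum π f n) (chainLaw Q ξ) l
      ≤ Real.exp (1 + 5 * l ^ 2 * asympVar Q π f * n) := by
  have h := lintegral_exp_centeredSum_le Q ξ π hf (measurable_lyapunov hQ hf hf1 l)
    (fun z => (abs_le.1 (abs_lyapunov_le hQ hf hf1 hl z)).2)
    (lintegral_exp_lyapunov_le hQ hf hf1 hl) n
  have hi := integrable_exp_centeredSum π hf hf1 (chainLaw Q ξ) n l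
  rw [mgf, ← ENNReal.ofReal_le_ofReal_iff (Real.exp_pos _).le,
    ofReal_integral_eq_lintegral_ofReal hi (ae_of_all _ fun y => (Real.exp_pos _).le)]
  calc ∫⁻ ω, ENNReal.ofReal (Real.exp (l * centeredSum π f n ω)) ∂(chainLaw Q ξ)
      ≤ ∫⁻ ω, ENNReal.ofReal (Real.exp (1 / 2))
          * ENNReal.ofReal (Real.exp (l * centeredSum π f n ω + lyapunov Q π f l (ω n)))
          ∂(chainLaw Q ξ) := by
        refine lintegral_mono fun ω => ?_
        rw [← ENNReal.ofReal_mul (Real.exp_pos _).le, ← Real.exp_add]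
        refine ENNReal.ofReal_le_ofReal (Real.exp_le_exp.2 ?_)
        linarith [(abs_le.1 (abs_lyapunov_le hQ hf hf1 hl (ω n))).1]
    _ ≤ ENNReal.ofReal (Real.exp (1 / 2))
          * ENNReal.ofReal (Real.exp (1 / 2 + 5 * l ^ 2 * asympVar Q π f * n)) := by
        rw [lintegral_const_mul' _ _ ENNReal.ofReal_ne_top]
        exact mul_le_mul_right h _
    _ = ENNReal.ofReal (Real.exp (1 + 5 * l ^ 2 * asympVar Q π f * n)) := by
        rw [← ENNReal.ofReal_mul (Real.exp_pos _).le, ← Real.exp_add]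
        congr 2
        ring

/-- The bound on the moment generating function is even in l, so Chernoff at l and at −l controls
both tails alike. -/
theorem measureReal_le_abs_centeredSum_le (hQ : IsUniformlyErgodic Q π τ) (hf : Measurable f)
    (hf1 : ∀ z, |f z| ≤ 1) (ξ : Measure Z) [IsProbabilityMeasure ξ] {l : ℝ} (hl0 : 0 ≤ l)
    (hl : l * τ ≤ 1 / 1000) (n : ℕ) (x : ℝ) :
    (chainLaw Q ξ).real {ω | x ≤ |centeredSum π f n ω|}
      ≤ 2 * Real.exp (1 + 5 * l ^ 2 * asympVar Q π f * n - l * x) := by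
  have hsub : {ω : ℕ → Z | x ≤ |centeredSum π f n ω|}
      ⊆ {ω | x ≤ centeredSum π f n ω} ∪ {ω | centeredSum π f n ω ≤ -x} := fun ω hω => by
    rcases le_abs.1 (show x ≤ |centeredSum π f n ω| from hω) with h | h
    · exact Or.inl h
    · exact Or.inr (show _ ≤ -x by linarith)
  have h1 := measure_ge_le_exp_mul_mgf x hl0
    (integrable_exp_centeredSum π hf hf1 (chainLaw Q ξ) n l)
  have h2 := measure_le_le_exp_mul_mgf (-x) (neg_nonpos.2 hl0)
    (integrable_exp_centeredSum π hf hf1 (chainLaw Q ξ) n (-l))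
  have m1 := mgf_centeredSum_le hQ hf hf1 ξ (l := l) (by rwa [abs_of_nonneg hl0]) n
  have m2 := mgf_centeredSum_le hQ hf hf1 ξ (l := -l) (by rwa [abs_neg, abs_of_nonneg hl0]) n
  have e1 : Real.exp (1 + 5 * l ^ 2 * asympVar Q π f * n - l * x)
      = Real.exp (-l * x) * Real.exp (1 + 5 * l ^ 2 * asympVar Q π f * n) := by
    rw [← Real.exp_add]; congr 1; ring
  rw [neg_sq] at m2
  have e2 : -(-l) * -x = -l * x := by ring
  rw [e2] at h2
  have b1 := h1.trans (mul_le_mul_of_nonneg_left m1 (Real.exp_pos (-l * x)).le)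
  have b2 := h2.trans (mul_le_mul_of_nonneg_left m2 (Real.exp_pos (-l * x)).le)
  rw [← e1] at b1 b2
  have := (measureReal_mono (μ := chainLaw Q ξ) hsub).trans (measureReal_union_le _ _)
  linarith

end Tail

/-! ### Numerical constants and choice of the exponent -/

section Constants

/-- Since δ ≤ 1/2, the inner argument is at least 2 ln 2 > 4/3, and (4/3)³ > 2. -/
theorem third_mul_log_le_lnTilde {δ : ℝ} (hδ : 0 < δ) (hδ2 : δ ≤ 1 / 2) :
    1 / 3 * Real.log (1 / δ) ≤ lnTilde (1 / δ) := by
  have h2 : Real.log 2 ≤ Real.log (1 / δ) :=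
    Real.log_le_log two_pos (by rw [le_div_iff₀ hδ]; linarith)
  have h3 := Real.log_two_gt_d9
  have h4 : (1 / 3 : ℝ) ≤ Real.logb 2 (2 * Real.log (1 / δ)) := by
    have h5 : (1 / 3 : ℝ) ≤ Real.logb 2 (4 / 3) := by
      have h6 : (1 : ℝ) ≤ Real.logb 2 ((4 / 3) ^ 3) := by
        rw [Real.le_logb_iff_rpow_le one_lt_two (by norm_num)]
        norm_num
      rw [Real.logb_pow] at h6
      norm_num at h6 ⊢
      linarith
    exact h5.trans (Real.logb_le_logb_of_le one_lt_two (by norm_num) (by linarith))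
  rw [lnTilde, mul_comm (1 / 3 : ℝ)]
  exact mul_le_mul_of_nonneg_left h4 (by linarith)

theorem CRm1_ge : 162 ≤ CRm1 := by
  rw [CRm1]; linarith [Real.exp_one_gt_d9]

theorem D1_nonneg : 0 ≤ D1 := by
  have := CRm1_ge
  rw [D1]; positivity

theorem D2_ge : 3000000 ≤ D2 := by
  have h1 := CRm1_ge
  have h2 : (7 : ℝ) ≤ Real.sqrt CRm2 := Real.le_sqrt_of_sq_le (by norm_num [CRm2])
  have h3 : (162 : ℝ) ^ 2 ≤ CRm1 ^ 2 := pow_le_pow_left₀ (by norm_num) h1 2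
  have h4 : (7 : ℝ) * 162 ^ 2 ≤ Real.sqrt CRm2 * CRm1 ^ 2 :=
    mul_le_mul h2 h3 (by norm_num) (Real.sqrt_nonneg _)
  rw [D2]
  norm_num [CRm2] at h4 ⊢
  linarith

end Constants

/-- Optimizing the exponential bound over `l ∈ [0, 1 / (1000 τ)]`. -/
theorem exists_exponent_le {A T L x : ℝ} (hA : 0 ≤ A) (hT : 0 < T) (hL : 1 / 2 ≤ L)
    (hx : 200 * (Real.sqrt L * A) + 1000000 * T * L ≤ x) :
    ∃ l : ℝ, 0 ≤ l ∧ l * T ≤ 1 / 1000 ∧ 1 + 5 * l ^ 2 * A ^ 2 - l * x ≤ -(2 * L) - 1 := by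
  have hs := Real.sq_sqrt (show 0 ≤ L by linarith)
  have hs0 := Real.sqrt_nonneg L
  set r := Real.sqrt L
  have hr : 0 < r := by nlinarith
  -- The Gaussian choice l = √L/A is used when it respects the cap 1/(1000T), and the cap itself
  -- otherwise (including A = 0). In both cases l²A² ≤ L and lx ≥ 200L, and L ≥ 1/2 absorbs the
  -- additive constants.
  by_cases h : r * (1000 * T) ≤ A
  · have hA0 : 0 < A := lt_of_lt_of_le (by positivity) h
    refine ⟨r / A, by positivity, ?_, ?_⟩
    · rw [div_mul_eq_mul_div, div_le_iff₀ hA0]; linarith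
    · have e1 : (r / A) ^ 2 * A ^ 2 = L := by
        rw [div_pow, div_mul_cancel₀ _ (by positivity), hs]
      have e2 : 200 * L ≤ r / A * x := by
        rw [div_mul_eq_mul_div, le_div_iff₀ hA0]
        have : 0 ≤ T * L := by nlinarith
        nlinarith
      linarith
  · rw [not_le] at h
    refine ⟨1 / (1000 * T), by positivity, by field_simp; norm_num, ?_⟩
    have e1 : (1 / (1000 * T)) ^ 2 * A ^ 2 ≤ L := by
      rw [div_pow, one_pow, div_mul_eq_mul_div, one_mul, div_le_iff₀ (by positivity), ← hs,
        ← mul_pow]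
      exact pow_le_pow_left₀ hA h.le 2
    have e2 : 200 * L ≤ 1 / (1000 * T) * x := by
      rw [div_mul_eq_mul_div, one_mul, le_div_iff₀ (by positivity)]
      have : 0 ≤ T * L := by nlinarith
      nlinarith [mul_nonneg hs0 hA]
    linarith

end MarkovBernstein

theorem corollary1 {Z : Type*} [MetricSpace Z] [CompleteSpace Z]
    [TopologicalSpace.SeparableSpace Z] [MeasurableSpace Z] [BorelSpace Z]
    (Q : ProbabilityTheory.Kernel Z Z) [ProbabilityTheory.IsMarkovKernel Q]
    (π : MeasureTheory.Measure Z) [MeasureTheory.IsProbabilityMeasure π] (τ : ℕ)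
    (hQ : MarkovBernstein.IsUniformlyErgodic Q π τ)
    (f : Z → ℝ) (hf : Measurable f) (hf1 : ∀ z, |f z| ≤ 1) :
    Summable (fun l : ℕ => MarkovBernstein.autocov Q π f (l + 1)) ∧
    0 ≤ MarkovBernstein.asympVar Q π f ∧
    ∀ (n : ℕ) (δ : ℝ), 0 < δ → δ ≤ 1 / 2 →
      (MarkovBernstein.chainLaw Q π).real
        {ω | MarkovBernstein.CRm1 * Real.sqrt 2 * Real.sqrt (n * Real.log (1 / δ)) *
                Real.sqrt (MarkovBernstein.asympVar Q π f)
              + MarkovBernstein.D1 * (n : ℝ) ^ (1 / 4 : ℝ) * (τ : ℝ) ^ (3 / 4 : ℝ) *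
                MarkovBernstein.lnTilde (1 / δ)
              + MarkovBernstein.D2 * τ * MarkovBernstein.lnTilde (1 / δ)
            ≤ |MarkovBernstein.centeredSum π f n ω|} ≤ δ := by
  refine ⟨((summable_nat_add_iff 1).2
      (MarkovBernstein.hasSum_autocov hQ hf hf1).summable),
    MarkovBernstein.asympVar_nonneg hQ hf hf1, fun n δ hδ hδ2 => ?_⟩
  have hv := MarkovBernstein.asympVar_nonneg hQ hf hf1
  set v := MarkovBernstein.asympVar Q π f with hvdef
  set L := Real.log (1 / δ) with hL
  have hLδ : Real.exp (-L) = δ := by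
    rw [hL, one_div, Real.log_inv, neg_neg, Real.exp_log hδ]
  have hL2 : 1 / 2 ≤ L := by
    have : Real.log 2 ≤ L :=
      Real.log_le_log two_pos (by rw [le_div_iff₀ hδ]; linarith)
    linarith [Real.log_two_gt_d9]
  have hlt : 1 / 3 * L ≤ MarkovBernstein.lnTilde (1 / δ) :=
    MarkovBernstein.third_mul_log_le_lnTilde hδ hδ2
  have hT : (1 : ℝ) ≤ τ := MarkovBernstein.one_le_tau hQ
  have hA0 : 0 ≤ Real.sqrt n * Real.sqrt v := by positivity
  set x := MarkovBernstein.CRm1 * Real.sqrt 2 * Real.sqrt (n * L) * Real.sqrt v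
    + MarkovBernstein.D1 * (n : ℝ) ^ (1 / 4 : ℝ) * (τ : ℝ) ^ (3 / 4 : ℝ) *
      MarkovBernstein.lnTilde (1 / δ)
    + MarkovBernstein.D2 * τ * MarkovBernstein.lnTilde (1 / δ) with hxdef
  have hx : 200 * (Real.sqrt L * (Real.sqrt n * Real.sqrt v)) + 1000000 * (τ : ℝ) * L ≤ x := by
    have c1 : 200 ≤ MarkovBernstein.CRm1 * Real.sqrt 2 := by
      have h2 : (1.4 : ℝ) ≤ Real.sqrt 2 := Real.le_sqrt_of_sq_le (by norm_num)
      nlinarith [MarkovBernstein.CRm1_ge]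
    have t1 : 200 * (Real.sqrt L * (Real.sqrt n * Real.sqrt v))
        ≤ MarkovBernstein.CRm1 * Real.sqrt 2 * Real.sqrt (n * L) * Real.sqrt v := by
      rw [Real.sqrt_mul (Nat.cast_nonneg n)]
      have := mul_le_mul_of_nonneg_right c1
        (show 0 ≤ Real.sqrt L * (Real.sqrt n * Real.sqrt v) by positivity)
      linarith
    have t2 : 0 ≤ MarkovBernstein.D1 * (n : ℝ) ^ (1 / 4 : ℝ) * (τ : ℝ) ^ (3 / 4 : ℝ) *
        MarkovBernstein.lnTilde (1 / δ) :=
      mul_nonneg (mul_nonneg (mul_nonneg MarkovBernstein.D1_nonneg (by positivity))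
        (by positivity)) (by linarith)
    -- The factor 1/3 lost in passing from the modified logarithm to L is paid by D₂ ≥ 3·10⁶.
    have t3 : 1000000 * (τ : ℝ) * L
        ≤ MarkovBernstein.D2 * τ * MarkovBernstein.lnTilde (1 / δ) := by
      have := mul_le_mul (mul_le_mul_of_nonneg_right MarkovBernstein.D2_ge
        (show (0 : ℝ) ≤ τ by linarith)) hlt (by linarith)
        (mul_nonneg (by linarith [MarkovBernstein.D2_ge]) (by linarith))
      linarith
    linarith
  obtain ⟨l, hl0, hl, hexp⟩ := MarkovBernstein.exists_exponent_le hA0 (by linarith) hL2 hx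
  refine (MarkovBernstein.measureReal_le_abs_centeredSum_le hQ hf hf1 π hl0 hl n x).trans ?_
  have hsq : (Real.sqrt n * Real.sqrt v) ^ 2 = v * n := by
    rw [mul_pow, Real.sq_sqrt (Nat.cast_nonneg n), Real.sq_sqrt hv, mul_comm]
  rw [hsq, ← mul_assoc] at hexp
  -- The extra factor e⁻¹ ≤ 1/2 cancels the 2 from the two tails.
  have hle : Real.exp (1 + 5 * l ^ 2 * v * n - l * x) ≤ Real.exp (-L) * Real.exp (-1) := by
    rw [← Real.exp_add]
    exact Real.exp_le_exp.2 (by linarith)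
  have h1 : Real.exp (-1) ≤ 1 / 2 := by
    rw [Real.exp_neg, inv_eq_one_div]
    exact one_div_le_one_div_of_le two_pos (by linarith [Real.exp_one_gt_d9])
  rw [hLδ] at hle
  nlinarith
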